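/- Conventions. A fibration is a Grothendieck fibration $P:\mathcal E\to\mathcal X$; an arrow is vertical if $P$ maps it to an isomorphism. The dual $P^\vee:\mathcal E^\vee\to\mathcal X$ of $P$ is the fibration whose total category has the objects of $\mathcal E$ and, as morphisms $e\to d$, isomorphism classes of spans $e\xleftarrow{v}a\xrightarrow{c}d$ with $v$ vertical and $c$ cartesian, composed by pulling back vertical arrows along cartesian ones; $P^\vee$ is $P$ on objects and sends $[v,c]$ to $P(v)^{-1}$ followed by $P(c)$. The iterated dual of a tower of fibrations $\mathcal E_2\xrightarrow{P_2}\mathcal E_1\xrightarrow{P_1}\mathcal E_0$ of height $2$ is the fibration over $\mathcal E_0$ $$(\mathcal E_2\xrightarrow{P_2}\mathcal E_1\xrightarrow{P_1}\mathcal E_0)^{\vee 2}:=(P_1\circ P_2^\vee)^\vee .$$ All pullbacks of categories are strict. (1) Simple case. Let $\mathcal C$ be a cartesian monoidal category and $P:\mathcal E\to\mathcal C$ a fibration. Let $\mathrm{Simple}(\mathcal C)$ have as objects pairs $(I,X)$ of objects of $\mathcal C$ and as morphisms $(I,X)\to(J,Y)$ pairs $(u:I\to J,\ f:I\times X\to Y)$,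 with the simple fibration $S:\mathrm{Simple}(\mathcal C)\to\mathcal C$, $(I,X)\mapsto I$, and the functor $\times:\mathrm{Simple}(\mathcal C)\to\mathcal C$, $(I,X)\mapsto I\times X$. For a fibration $R:\mathcal F\to\mathcal C$ let $\mathbf{Sum}(R)$ be the composite of the pullback of $R$ along $\times$ (a fibration over $\mathrm{Simple}(\mathcal C)$) with $S$, and write $\mathbf{Sum}(R)$ also for its total category; put $\mathbf{Prod}(R)=\mathbf{Sum}(R^\vee)^\vee$ and $\mathbf{Dial}(P)=\mathbf{Sum}(\mathbf{Prod}(P))$, which is a fibration over $\mathcal C$. Consider the tower of fibrations $$\mathbf{Sum}(\mathbf{Sum}(P))\xrightarrow{Q_3}\mathbf{Sum}(S)=\mathrm{Simple}(\mathcal C)\times_{\mathcal C}\mathrm{Simple}(\mathcal C)\xrightarrow{Q_2}\mathrm{Simple}(\mathcal C)\xrightarrow{Q_1=S}\mathcal C,$$ where $Q_2$ is the pullback of $S$ along $\times$ and $Q_3$ is the functor induced on pullbacks along $\times$ by the functor $\mathbf{Sum}(P)\to\mathrm{Simple}(\mathcal C)$ over $\mathcal C$. Then there is an isomorphism of categories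 over $\mathcal C$ $$\mathbf{Dial}(P)\;\cong\;\Bigl(\mathbf{Sum}(\mathbf{Sum}(P))\xrightarrow{Q_3}\mathbf{Sum}(S)\xrightarrow{Q_2}\mathrm{Simple}(\mathcal C)\Bigr)^{\vee 2}\xrightarrow{Q_1}\mathcal C ,$$ which is moreover compatible with the projections to $\mathrm{Simple}(\mathcal C)$ and is the identity on objects (on both sides these are the quadruples $(I,X,U,\alpha)$ with $I,X,U$ in $\mathcal C$ and $\alpha$ in the fibre of $P$ over $(I\times X)\times U$). (2) Dependent case. Let $\mathcal X$ be a category with pullbacks and $P:\mathcal E\to\mathcal X$ a fibration. Let $\mathcal X^{\downarrow}$ be the arrow category of $\mathcal X$. For a fibration $R$ over $\mathcal X$ let $\mathbf{Fam}(R)$ be the composite of the pullback of $R$ along $\mathrm{dom}:\mathcal X^\downarrow\to\mathcal X$ with $\mathrm{cod}:\mathcal X^\downarrow\to\mathcal X$, put $\mathbf{Cofam}(R)=\mathbf{Fam}(R^\vee)^\vee$, and consider the tower $$\mathbf{Fam}(\mathbf{Fam}(P))\xrightarrow{Q_3}\mathbf{Fam}(\mathrm{cod})\xrightarrow{Q_2}\mathcal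 X^\downarrow\xrightarrow{Q_1=\mathrm{cod}}\mathcal X ,$$ where $Q_2$ is the pullback of $\mathrm{cod}$ along $\mathrm{dom}$ and $Q_3$ is induced by the functor $\mathbf{Fam}(P)\to\mathcal X^\downarrow$ over $\mathcal X$. Then there is an isomorphism of categories over $\mathcal X$ $$\mathbf{Fam}(\mathbf{Cofam}(P))\;\cong\;\Bigl(\mathbf{Fam}(\mathbf{Fam}(P))\xrightarrow{Q_3}\mathbf{Fam}(\mathrm{cod})\xrightarrow{Q_2}\mathcal X^\downarrow\Bigr)^{\vee 2}\xrightarrow{Q_1}\mathcal X ,$$ compatible with the projections to $\mathcal X^\downarrow$ and the identity on objects. -/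

import Mathlib

open CategoryTheory CategoryTheory.Limits MonoidalCategory

universe v₁ v₂ v₃ v₄ u₁ u₂ u₃ u₄

namespace Dialens

/-! ## Cartesian arrows and fibrations -/

section Fibrations

variable {E : Type u₁} [Category.{v₁} E] {X : Type u₂} [Category.{v₂} X]

/-- A morphism `φ` of `E` is (strongly) `P`-cartesian (over its own image `P.map φ`). -/
abbrev IsCart (P : E ⥤ X) {e d : E} (φ : e ⟶ d) : Prop :=
  P.IsStronglyCartesian (P.map φ) φ

/-- The left class of the vertical-cartesian factorization system: the maps projecting to
isomorphisms. -/
abbrev IsVert (P : E ⥤ X) {e d : E} (φ : e ⟶ d) : Prop :=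
  IsIso (P.map φ)

theorem isHomLift_self_iff (P : E ⥤ X) {e d : E} (g : P.obj e ⟶ P.obj d) (φ : e ⟶ d) :
    P.IsHomLift g φ ↔ P.map φ = g := by
  constructor
  · intro h
    exact (IsHomLift.eq_of_isHomLift P g φ).symm
  · rintro rfl
    infer_instance

theorem isCart_iff (P : E ⥤ X) {e d : E} (φ : e ⟶ d) :
    IsCart P φ ↔ ∀ {a : E} (g : P.obj a ⟶ P.obj e) (ψ : a ⟶ d), P.map ψ = g ≫ P.map φ →
      ∃! χ : a ⟶ e, P.map χ = g ∧ χ ≫ φ = ψ := by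
  constructor
  · intro h a g ψ hψ
    have := (isHomLift_self_iff P (g ≫ P.map φ) ψ).2 hψ
    obtain ⟨χ, ⟨h1, h2⟩, h3⟩ := h.universal_property' g ψ
    refine ⟨χ, ⟨(isHomLift_self_iff P g χ).1 h1, h2⟩, ?_⟩
    rintro y ⟨hy1, hy2⟩
    exact h3 y ⟨(isHomLift_self_iff P g y).2 hy1, hy2⟩
  · intro h
    refine { universal_property' := ?_ }
    intro a g ψ hψ
    obtain ⟨χ, ⟨h1, h2⟩, h3⟩ := h g ψ ((isHomLift_self_iff P _ ψ).1 hψ)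
    refine ⟨χ, ⟨(isHomLift_self_iff P g χ).2 h1, h2⟩, ?_⟩
    rintro y ⟨hy1, hy2⟩
    exact h3 y ⟨(isHomLift_self_iff P g y).1 hy1, hy2⟩

variable {P : E ⥤ X}

theorem IsCart.exists_lift {e d : E} {φ : e ⟶ d} (h : IsCart P φ) {a : E}
    (g : P.obj a ⟶ P.obj e) (ψ : a ⟶ d) (hψ : P.map ψ = g ≫ P.map φ) :
    ∃ χ : a ⟶ e, P.map χ = g ∧ χ ≫ φ = ψ :=
  ((isCart_iff P φ).1 h g ψ hψ).exists

theorem IsCart.hom_ext {e d : E} {φ : e ⟶ d} (h : IsCart P φ) {a : E} {χ χ' : a ⟶ e}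
    (h₁ : P.map χ = P.map χ') (h₂ : χ ≫ φ = χ' ≫ φ) : χ = χ' :=
  ((isCart_iff P φ).1 h (P.map χ') (χ' ≫ φ) (by simp)).unique ⟨h₁, h₂⟩ ⟨rfl, rfl⟩

theorem IsCart.comp {e d c : E} {φ : e ⟶ d} {ψ : d ⟶ c} (h₁ : IsCart P φ) (h₂ : IsCart P ψ) :
    IsCart P (φ ≫ ψ) := by
  unfold IsCart
  rw [P.map_comp]
  infer_instance

theorem IsCart.of_comp {e d c : E} {φ : e ⟶ d} {ψ : d ⟶ c} (h₂ : IsCart P ψ)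
    (h : IsCart P (φ ≫ ψ)) : IsCart P φ := by
  unfold IsCart at h
  rw [P.map_comp] at h
  exact Functor.IsStronglyCartesian.of_comp (p := P) (g := P.map ψ) (ψ := ψ)

theorem IsCart.of_isIso {e d : E} (φ : e ⟶ d) [IsIso φ] : IsCart P φ :=
  Functor.IsStronglyCartesian.of_isIso P (P.map φ) φ

theorem IsCart.isIso {e d : E} {φ : e ⟶ d} (h : IsCart P φ) (hv : IsVert P φ) : IsIso φ :=
  Functor.IsStronglyCartesian.isIso_of_base_isIso P (P.map φ) φ

theorem exists_cart_lift (P : E ⥤ X) [P.IsFibered] (d : E) {x : X} (f : x ⟶ P.obj d) :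
    ∃ (e : E) (φ : e ⟶ d) (h : P.obj e = x), P.map φ = eqToHom h ≫ f ∧ IsCart P φ := by
  obtain ⟨e, φ, hφ⟩ := Functor.IsPreFibered.exists_isCartesian' (p := P) f
  have h2 : P.IsStronglyCartesian f φ := inferInstance
  have h := IsHomLift.domain_eq P f φ
  subst h
  obtain rfl := (isHomLift_self_iff P f φ).1 inferInstance
  exact ⟨e, φ, rfl, by simp, h2⟩

theorem isFibered_of_exists (P : E ⥤ X)
    (H : ∀ (d : E) (x : X) (f : x ⟶ P.obj d),
      ∃ (e : E) (φ : e ⟶ d) (h : P.obj e = x), P.map φ = eqToHom h ≫ f ∧ IsCart P φ) :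
    P.IsFibered := by
  refine Functor.IsFibered.of_exists_isStronglyCartesian fun d x f => ?_
  obtain ⟨e, φ, rfl, hf, hc⟩ := H d x f
  refine ⟨e, φ, ?_⟩
  simp only [eqToHom_refl, Category.id_comp] at hf
  rw [← hf]
  exact hc

/-- Fibrations compose. -/
instance isFibered_comp {B : Type u₃} [Category.{v₃} B] (P : E ⥤ X) (Q : X ⥤ B)
    [P.IsFibered] [Q.IsFibered] : (P ⋙ Q).IsFibered := by
  refine isFibered_of_exists _ fun d x f => ?_
  obtain ⟨y, φ, rfl, hφ, hφc⟩ := exists_cart_lift Q (P.obj d) f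
  obtain ⟨e, ψ, rfl, hψ, hψc⟩ := exists_cart_lift P d φ
  simp only [eqToHom_refl, Category.id_comp] at hφ hψ
  refine ⟨e, ψ, rfl, by simp [hψ, hφ], (isCart_iff _ _).2 fun {a} g χ hχ => ?_⟩
  subst hψ
  obtain ⟨k, hk, hk'⟩ := hφc.exists_lift g (P.map χ) hχ
  obtain ⟨l, hl, hl'⟩ := hψc.exists_lift k χ hk'.symm
  refine ⟨l, ⟨by simp [hl, hk], hl'⟩, ?_⟩
  rintro y ⟨hy, hy'⟩
  refine hψc.hom_ext (hφc.hom_ext ?_ ?_) (hy'.trans hl'.symm)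
  · rw [hl, hk]
    exact hy
  · rw [hl, hk', ← P.map_comp, hy']

end Fibrations

/-! ## The dual (fibrewise opposite) of a fibration -/

section Dual

variable {E : Type u₁} [Category.{v₁} E] {X : Type u₂} [Category.{v₂} X]

/-- A vertical-cartesian span `e ⟵ apex ⟶ d`. -/
structure Span (P : E ⥤ X) (e d : E) where
  apex : E
  left : apex ⟶ e
  right : apex ⟶ d
  vert : IsVert P left
  cart : IsCart P right

/-- Two spans are equivalent if they are isomorphic as spans. -/
def Span.Rel {P : E ⥤ X} {e d : E} (s t : Span P e d) : Prop :=
  ∃ θ : s.apex ≅ t.apex, θ.hom ≫ t.left = s.left ∧ θ.hom ≫ t.right = s.right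

instance Span.setoid (P : E ⥤ X) (e d : E) : Setoid (Span P e d) where
  r := Span.Rel
  iseqv :=
    { refl := fun s => ⟨Iso.refl _, by simp, by simp⟩
      symm := by
        rintro s t ⟨θ, h₁, h₂⟩
        exact ⟨θ.symm, by simp [← h₁], by simp [← h₂]⟩
      trans := by
        rintro s t r ⟨θ, h₁, h₂⟩ ⟨η, h₃, h₄⟩
        exact ⟨θ ≪≫ η, by simp [h₁, h₃], by simp [h₂, h₄]⟩ }

/-- Morphisms `e ⟶ d` of the dual: equivalence classes of vertical-cartesian spans. -/
def DualHom (P : E ⥤ X) (e d : E) := Quotient (Span.setoid P e d)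

variable {P : E ⥤ X}

theorem Span.rel_of_hom {e d : E} {s t : Span P e d} (θ : s.apex ⟶ t.apex)
    (h₁ : θ ≫ t.left = s.left) (h₂ : θ ≫ t.right = s.right) : s ≈ t := by
  have hv : IsVert P θ := by
    have := s.vert
    have := t.vert
    have e1 : P.map θ ≫ P.map t.left = P.map s.left := by rw [← P.map_comp, h₁]
    have : IsIso (P.map θ ≫ P.map t.left) := by rw [e1]; exact s.vert
    exact IsIso.of_isIso_comp_right _ (P.map t.left)
  have hc : IsCart P θ := t.cart.of_comp (by rw [h₂]; exact s.cart)
  have := hc.isIso hv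
  exact ⟨asIso θ, h₁, h₂⟩

/-- A cospan with `c` cartesian and `w` vertical completes to a commutative square with parallel
sides of the same kind (which is then a pullback square). -/
theorem exists_square (P : E ⥤ X) [P.IsFibered] {a b y : E} (c : a ⟶ y) (w : b ⟶ y)
    (hc : IsCart P c) (hw : IsVert P w) :
    ∃ (u : E) (w' : u ⟶ a) (c' : u ⟶ b), IsVert P w' ∧ IsCart P c' ∧ w' ≫ c = c' ≫ w := by
  obtain ⟨u, c', rfl', hc', hcc⟩ := exists_cart_lift P b (P.map c ≫ inv (P.map w))
  obtain ⟨w', hw', hw''⟩ := hc.exists_lift (eqToHom rfl') (c' ≫ w) (by simp [hc'])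
  refine ⟨u, w', c', ?_, hcc, hw''⟩
  unfold IsVert
  rw [hw']
  infer_instance

/-- The composite span along a given square. -/
def Span.paste {e d c : E} (s : Span P e d) (t : Span P d c) {u : E} (w : u ⟶ s.apex)
    (k : u ⟶ t.apex) (hw : IsVert P w) (hk : IsCart P k) : Span P e c where
  apex := u
  left := w ≫ s.left
  right := k ≫ t.right
  vert := by
    have := s.vert
    have := hw
    unfold IsVert
    rw [P.map_comp]
    infer_instance
  cart := hk.comp t.cart

theorem Span.paste_rel {e d c : E} {s s' : Span P e d} {t t' : Span P d c}
    (hs : s ≈ s') (ht : t ≈ t')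
    {u u' : E} {w : u ⟶ s.apex} {k : u ⟶ t.apex} {hw : IsVert P w} {hk : IsCart P k}
    {w' : u' ⟶ s'.apex} {k' : u' ⟶ t'.apex} {hw' : IsVert P w'} {hk' : IsCart P k'}
    (h : w ≫ s.right = k ≫ t.left) (h' : w' ≫ s'.right = k' ≫ t'.left) :
    s.paste t w k hw hk ≈ s'.paste t' w' k' hw' hk' := by
  obtain ⟨θ, hθ₁, hθ₂⟩ := hs
  obtain ⟨η, hη₁, hη₂⟩ := ht
  have := t'.vert
  have e1 : P.map (k ≫ η.hom) = (P.map (w ≫ θ.hom) ≫ inv (P.map w')) ≫ P.map k' := by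
    rw [← cancel_mono (P.map t'.left), Category.assoc, Category.assoc, ← P.map_comp k', ← h',
      P.map_comp w', IsIso.inv_hom_id_assoc, ← P.map_comp, ← P.map_comp, Category.assoc,
      Category.assoc, hη₁, hθ₂, h]
  obtain ⟨χ, hχ₁, hχ₂⟩ := hk'.exists_lift _ _ e1
  have e2 : χ ≫ w' = w ≫ θ.hom := by
    refine s'.cart.hom_ext ?_ ?_
    · rw [P.map_comp, hχ₁]
      simp
    · rw [Category.assoc, h', ← Category.assoc, hχ₂, Category.assoc, hη₁, Category.assoc, hθ₂, h]
  refine Span.rel_of_hom (s := s.paste t w k hw hk) (t := s'.paste t' w' k' hw' hk') χ ?_ ?_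
  · change χ ≫ w' ≫ s'.left = w ≫ s.left
    rw [← Category.assoc, e2, Category.assoc, hθ₁]
  · change χ ≫ k' ≫ t'.right = k ≫ t.right
    rw [← Category.assoc, hχ₂, Category.assoc, hη₂]

/-- Composition of spans, by pulling back the second vertical leg along the first cartesian
leg. -/
noncomputable def Span.comp [P.IsFibered] {e d c : E} (s : Span P e d) (t : Span P d c) :
    Span P e c :=
  have h := exists_square P s.right t.left s.cart t.vert
  s.paste t h.choose_spec.choose h.choose_spec.choose_spec.choose
    h.choose_spec.choose_spec.choose_spec.1 h.choose_spec.choose_spec.choose_spec.2.1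

theorem Span.comp_eq_paste [P.IsFibered] {e d c : E} (s : Span P e d) (t : Span P d c) :
    ∃ (u : E) (w : u ⟶ s.apex) (k : u ⟶ t.apex) (hw : IsVert P w) (hk : IsCart P k),
      w ≫ s.right = k ≫ t.left ∧ s.comp t = s.paste t w k hw hk :=
  have h := exists_square P s.right t.left s.cart t.vert
  ⟨_, _, _, h.choose_spec.choose_spec.choose_spec.1, h.choose_spec.choose_spec.choose_spec.2.1,
    h.choose_spec.choose_spec.choose_spec.2.2, rfl⟩

theorem Span.comp_rel_paste [P.IsFibered] {e d c : E} {s s' : Span P e d} {t t' : Span P d c}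
    (hs : s ≈ s') (ht : t ≈ t') {u : E} {w : u ⟶ s'.apex} {k : u ⟶ t'.apex}
    {hw : IsVert P w} {hk : IsCart P k} (h : w ≫ s'.right = k ≫ t'.left) :
    s.comp t ≈ s'.paste t' w k hw hk := by
  obtain ⟨_, _, _, _, _, h', e⟩ := s.comp_eq_paste t
  rw [e]
  exact Span.paste_rel hs ht h' h

theorem Span.comp_rel [P.IsFibered] {e d c : E} {s s' : Span P e d} {t t' : Span P d c}
    (hs : s ≈ s') (ht : t ≈ t') : s.comp t ≈ s'.comp t' := by
  obtain ⟨_, _, _, _, _, h', e⟩ := s'.comp_eq_paste t'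
  rw [e]
  exact Span.comp_rel_paste hs ht h'

/-- The identity span. -/
def Span.id (P : E ⥤ X) (e : E) : Span P e e where
  apex := e
  left := 𝟙 e
  right := 𝟙 e
  vert := by unfold IsVert; infer_instance
  cart := IsCart.of_isIso _

theorem Span.id_comp_rel [P.IsFibered] {e d : E} (s : Span P e d) : (Span.id P e).comp s ≈ s := by
  refine Setoid.trans (Span.comp_rel_paste (Setoid.refl _) (Setoid.refl _)
    (w := s.left) (k := 𝟙 _) (hw := s.vert) (hk := IsCart.of_isIso _) ?_) ?_
  · simp [Span.id]
  · exact Span.rel_of_hom (𝟙 s.apex) (by simp [Span.paste, Span.id]) (by simp [Span.paste])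

theorem Span.comp_id_rel [P.IsFibered] {e d : E} (s : Span P e d) : s.comp (Span.id P d) ≈ s := by
  refine Setoid.trans (Span.comp_rel_paste (Setoid.refl _) (Setoid.refl _)
    (w := 𝟙 _) (k := s.right) (hw := by unfold IsVert; infer_instance) (hk := s.cart) ?_) ?_
  · simp [Span.id]
  · exact Span.rel_of_hom (𝟙 s.apex) (by simp [Span.paste]) (by simp [Span.paste, Span.id])

theorem Span.assoc_rel [P.IsFibered] {a b c d : E} (s : Span P a b) (t : Span P b c)
    (r : Span P c d) : (s.comp t).comp r ≈ s.comp (t.comp r) := by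
  obtain ⟨u, w, k, hw, hk, h⟩ := exists_square P s.right t.left s.cart t.vert
  obtain ⟨u', w', k', hw', hk', h'⟩ := exists_square P t.right r.left t.cart r.vert
  obtain ⟨z, p, q, hp, hq, hpq⟩ := exists_square P k w' hk hw'
  have hpw : IsVert P (p ≫ w) := by
    unfold IsVert at *
    rw [P.map_comp]
    infer_instance
  have h1 : (s.comp t).comp r ≈ (s.paste t w k hw hk).paste r p (q ≫ k') hp (hq.comp hk') :=
    Span.comp_rel_paste (Span.comp_rel_paste (Setoid.refl _) (Setoid.refl _) h) (Setoid.refl _)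
      (by simp only [Span.paste]; rw [← Category.assoc, hpq, Category.assoc, Category.assoc, h'])
  have h2 : s.comp (t.comp r) ≈ s.paste (t.paste r w' k' hw' hk') (p ≫ w) q hpw hq :=
    Span.comp_rel_paste (Setoid.refl _) (Span.comp_rel_paste (Setoid.refl _) (Setoid.refl _) h')
      (by simp only [Span.paste]; rw [Category.assoc, h, ← Category.assoc, hpq, Category.assoc])
  refine Setoid.trans h1 (Setoid.trans ?_ (Setoid.symm h2))
  exact Span.rel_of_hom (𝟙 z) (by simp [Span.paste]) (by simp [Span.paste])

/-- The total category of the dual of `P`: it has the same objects as the total category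
of `P`. -/
structure Dual (P : E ⥤ X) where
  of : E

noncomputable instance Dual.category (P : E ⥤ X) [P.IsFibered] : Category (Dual P) where
  Hom e d := DualHom P e.of d.of
  id e := Quotient.mk _ (Span.id P e.of)
  comp f g := Quotient.map₂ Span.comp (fun _ _ hs _ _ ht => Span.comp_rel hs ht) f g
  id_comp f := by
    induction f using Quotient.inductionOn with
    | _ s => exact Quotient.sound (Span.id_comp_rel s)
  comp_id f := by
    induction f using Quotient.inductionOn with
    | _ s => exact Quotient.sound (Span.comp_id_rel s)
  assoc f g h := by
    induction f using Quotient.inductionOn with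
    | _ s =>
      induction g using Quotient.inductionOn with
      | _ t =>
        induction h using Quotient.inductionOn with
        | _ r => exact Quotient.sound (Span.assoc_rel s t r)

/-- The morphism of the base underlying a span. -/
noncomputable def Span.base {e d : E} (s : Span P e d) : P.obj e ⟶ P.obj d :=
  haveI := s.vert
  inv (P.map s.left) ≫ P.map s.right

theorem Span.map_left_base {e d : E} (s : Span P e d) :
    P.map s.left ≫ s.base = P.map s.right := by
  have := s.vert
  simp [Span.base]

theorem Span.base_unique {e d : E} (s : Span P e d) (f : P.obj e ⟶ P.obj d)
    (h : P.map s.left ≫ f = P.map s.right) : s.base = f := by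
  have := s.vert
  rw [← cancel_epi (P.map s.left), s.map_left_base, h]

theorem Span.base_eq_of_rel {e d : E} {s t : Span P e d} (h : s ≈ t) : s.base = t.base := by
  obtain ⟨θ, h₁, h₂⟩ := h
  refine s.base_unique _ ?_
  rw [← h₁, ← h₂, P.map_comp, P.map_comp, Category.assoc, t.map_left_base]

theorem Span.paste_base {e d c : E} (s : Span P e d) (t : Span P d c) {u : E} {w : u ⟶ s.apex}
    {k : u ⟶ t.apex} {hw : IsVert P w} {hk : IsCart P k} (h : w ≫ s.right = k ≫ t.left) :
    (s.paste t w k hw hk).base = s.base ≫ t.base := by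
  refine Span.base_unique _ _ ?_
  simp only [Span.paste]
  rw [P.map_comp, P.map_comp, Category.assoc, ← Category.assoc (P.map s.left), s.map_left_base,
    ← Category.assoc, ← P.map_comp, h, P.map_comp, Category.assoc, t.map_left_base]

/-- The dual `P^∨ : E^∨ ⥤ X` of a fibration `P : E ⥤ X`. -/
noncomputable def dual (P : E ⥤ X) [P.IsFibered] : Dual P ⥤ X where
  obj e := P.obj e.of
  map f := Quotient.lift Span.base (fun _ _ h => Span.base_eq_of_rel h) f
  map_id e := Span.base_unique _ _ (by simp [Span.id])
  map_comp f g := by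
    induction f using Quotient.inductionOn with
    | _ s =>
      induction g using Quotient.inductionOn with
      | _ t =>
        obtain ⟨_, _, _, _, _, h, e⟩ := s.comp_eq_paste t
        exact (congrArg Span.base e).trans (Span.paste_base s t h)

/-- The morphism of the dual represented by a cartesian arrow. -/
def Span.ofCart {e d : E} (φ : e ⟶ d) (h : IsCart P φ) : Span P e d where
  apex := e
  left := 𝟙 e
  right := φ
  vert := by unfold IsVert; infer_instance
  cart := h

/-- The dual of a fibration is a fibration. -/
instance dual_isFibered (P : E ⥤ X) [P.IsFibered] : (dual P).IsFibered := by
  refine isFibered_of_exists _ fun d x f => ?_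
  obtain ⟨e, φ, rfl, hφ, hφc⟩ := exists_cart_lift P d.of f
  simp only [eqToHom_refl] at hφ
  have hb : (Span.ofCart φ hφc).base = P.map φ :=
    Span.base_unique _ _ (by simp [Span.ofCart])
  let Φ : (⟨e⟩ : Dual P) ⟶ d := Quotient.mk _ (Span.ofCart φ hφc)
  have hΦ : (dual P).map Φ = P.map φ := hb
  refine ⟨⟨e⟩, Φ, rfl, ?_, (isCart_iff _ _).2 fun {a} g ψ hψ => ?_⟩
  · rw [hΦ, hφ]
    rfl
  rw [hΦ] at hψ
  induction ψ using Quotient.inductionOn with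
  | _ s =>
    change P.obj a.of ⟶ P.obj e at g
    have hs : s.base = g ≫ P.map φ := hψ
    have key : P.map s.right = (P.map s.left ≫ g) ≫ P.map φ := by
      rw [Category.assoc, ← hs, s.map_left_base]
    obtain ⟨k, hk, hk'⟩ := hφc.exists_lift _ _ key
    let t : Span P a.of e :=
      ⟨s.apex, s.left, k, s.vert, hφc.of_comp (by rw [hk']; exact s.cart)⟩
    have comp_ofCart : ∀ r : Span P a.of e, r.comp (Span.ofCart φ hφc) ≈
        ⟨r.apex, r.left, r.right ≫ φ, r.vert, r.cart.comp hφc⟩ := by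
      intro r
      refine Setoid.trans (Span.comp_rel_paste (Setoid.refl _) (Setoid.refl _)
        (w := 𝟙 _) (k := r.right) (hw := by unfold IsVert; infer_instance) (hk := r.cart) ?_) ?_
      · simp [Span.ofCart]
      · exact Span.rel_of_hom (𝟙 r.apex) (by simp [Span.paste]) (by simp [Span.paste, Span.ofCart])
    refine ⟨Quotient.mk _ t, ⟨t.base_unique _ hk.symm, ?_⟩, ?_⟩
    · refine Quotient.sound (Setoid.trans (comp_ofCart t) ?_)
      exact Span.rel_of_hom (𝟙 s.apex) (by simp [t]) (by simp [t, hk'])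
    · intro y hy
      induction y using Quotient.inductionOn with
      | _ r =>
        obtain ⟨hy₁, hy₂⟩ := hy
        have hy₁' : r.base = g := hy₁
        have hy₂' : r.comp (Span.ofCart φ hφc) ≈ s := Quotient.exact hy₂
        obtain ⟨θ, hθ₁, hθ₂⟩ := Setoid.trans (Setoid.symm (comp_ofCart r)) hy₂'
        refine Quotient.sound (Span.rel_of_hom θ.hom hθ₁ ?_)
        simp only at hθ₁ hθ₂
        refine hφc.hom_ext ?_ ?_
        · simp only [t]
          rw [P.map_comp, hk, ← Category.assoc, ← P.map_comp, hθ₁, ← hy₁', r.map_left_base]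
        · simp only [t, Category.assoc]
          rw [hk', hθ₂]

end Dual

/-! ## Iterated duals of towers of fibrations -/

section IteratedDual

variable {E₂ : Type u₁} [Category.{v₁} E₂] {E₁ : Type u₂} [Category.{v₂} E₁]
  {E₀ : Type u₃} [Category.{v₃} E₀]

/-- The total category of the iterated dual of the tower of height two `E₂ ⟶ E₁ ⟶ E₀`: first take
the dual of `P₂` over `E₁`, then the dual over `E₀` of the resulting fibration over `E₀`. -/
abbrev IteratedDual (P₂ : E₂ ⥤ E₁) (P₁ : E₁ ⥤ E₀) [P₂.IsFibered] [P₁.IsFibered] :=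
  Dual (dual P₂ ⋙ P₁)

/-- The iterated dual of the tower of height two `E₂ ⟶ E₁ ⟶ E₀`, as a fibration over `E₀`. -/
noncomputable abbrev iteratedDual (P₂ : E₂ ⥤ E₁) (P₁ : E₁ ⥤ E₀) [P₂.IsFibered] [P₁.IsFibered] :
    IteratedDual P₂ P₁ ⥤ E₀ :=
  dual (dual P₂ ⋙ P₁)

end IteratedDual

/-! ## Strict pullbacks of categories -/

section Pullback

variable {B : Type u₁} [Category.{v₁} B] {E : Type u₂} [Category.{v₂} E]
  {X : Type u₃} [Category.{v₃} X]

/-- The (strict) pullback of categories `B ×_X E`. -/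
structure Pullback (F : B ⥤ X) (P : E ⥤ X) where
  fst : B
  snd : E
  w : F.obj fst = P.obj snd

namespace Pullback

variable {F : B ⥤ X} {P : E ⥤ X}

/-- Morphisms of the strict pullback: pairs of morphisms with the same image in `X`. -/
@[ext]
structure Hom (x y : Pullback F P) where
  fst : x.fst ⟶ y.fst
  snd : x.snd ⟶ y.snd
  w : F.map fst ≫ eqToHom y.w = eqToHom x.w ≫ P.map snd

instance : Category (Pullback F P) where
  Hom := Hom
  id x := ⟨𝟙 _, 𝟙 _, by simp⟩
  comp f g := ⟨f.fst ≫ g.fst, f.snd ≫ g.snd, by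
    rw [F.map_comp, P.map_comp, Category.assoc, g.w, ← Category.assoc, f.w, Category.assoc]⟩
  id_comp f := Hom.ext (Category.id_comp _) (Category.id_comp _)
  comp_id f := Hom.ext (Category.comp_id _) (Category.comp_id _)
  assoc f g h := Hom.ext (Category.assoc _ _ _) (Category.assoc _ _ _)

@[ext]
theorem hom_ext {x y : Pullback F P} {f g : x ⟶ y} (h₁ : f.fst = g.fst) (h₂ : f.snd = g.snd) :
    f = g :=
  Hom.ext h₁ h₂

@[simp] theorem id_fst (x : Pullback F P) : Hom.fst (𝟙 x) = 𝟙 x.fst := rfl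
@[simp] theorem id_snd (x : Pullback F P) : Hom.snd (𝟙 x) = 𝟙 x.snd := rfl
@[simp] theorem comp_fst {x y z : Pullback F P} (f : x ⟶ y) (g : y ⟶ z) :
    (f ≫ g).fst = f.fst ≫ g.fst := rfl
@[simp] theorem comp_snd {x y z : Pullback F P} (f : x ⟶ y) (g : y ⟶ z) :
    (f ≫ g).snd = f.snd ≫ g.snd := rfl

variable (F P)

/-- The first projection of the pullback; this is the pullback `F^*P` of `P` along `F`. -/
@[simps]
def fstFunctor : Pullback F P ⥤ B where
  obj x := x.fst
  map f := f.fst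

/-- The pullback of a fibration along any functor is a fibration. -/
instance fstFunctor_isFibered [P.IsFibered] : (fstFunctor F P).IsFibered := by
  refine isFibered_of_exists _ fun d x f => ?_
  change x ⟶ d.fst at f
  obtain ⟨e, φ, he, hφ, hφc⟩ := exists_cart_lift P d.snd (F.map f ≫ eqToHom d.w)
  let y : Pullback F P := ⟨x, e, he.symm⟩
  let Φ : y ⟶ d := ⟨f, φ, by rw [hφ]; simp [y]⟩
  refine ⟨y, Φ, rfl, (Category.id_comp _).symm, (isCart_iff _ _).2 fun {a} g ψ hψ => ?_⟩
  change a.fst ⟶ x at g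
  have hψ' : ψ.fst = g ≫ f := hψ
  have e1 : P.map ψ.snd = (eqToHom a.w.symm ≫ F.map g ≫ eqToHom y.w) ≫ P.map φ := by
    rw [hφ, ← cancel_epi (eqToHom a.w), ← ψ.w, hψ']
    simp
  obtain ⟨χ, hχ, hχ'⟩ := hφc.exists_lift _ _ e1
  refine ⟨⟨g, χ, by rw [hχ]; simp⟩, ⟨rfl, Pullback.hom_ext hψ'.symm hχ'⟩, ?_⟩
  rintro z ⟨hz, hz'⟩
  have hz1 : z.fst = g := hz
  refine Pullback.hom_ext hz1 (hφc.hom_ext ?_ ?_)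
  · rw [hχ, ← cancel_epi (eqToHom a.w), ← z.w, hz1]
    simp
  · rw [hχ', ← hz']
    rfl

variable {G : Type u₄} [Category.{v₄} G]

/-- The functor `B ×_X G ⥤ B ×_X E` induced by a functor `R : G ⥤ E` over `X`. -/
@[simps]
def mapSnd (R : G ⥤ E) : Pullback F (R ⋙ P) ⥤ Pullback F P where
  obj x := ⟨x.fst, R.obj x.snd, x.w⟩
  map f := ⟨f.fst, R.map f.snd, f.w⟩

instance mapSnd_isFibered (R : G ⥤ E) [R.IsFibered] : (mapSnd F P R).IsFibered := by
  refine isFibered_of_exists _ fun d x f => ?_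
  obtain ⟨b, e, w⟩ := x
  obtain ⟨f₁, f₂, hf⟩ := f
  change e ⟶ R.obj d.snd at f₂
  change b ⟶ d.fst at f₁
  obtain ⟨g, φ, rfl, hφ, hφc⟩ := exists_cart_lift R d.snd f₂
  simp only [eqToHom_refl, Category.id_comp] at hφ
  subst hφ
  let y : Pullback F (R ⋙ P) := ⟨b, g, w⟩
  let Φ : y ⟶ d := ⟨f₁, φ, hf⟩
  refine ⟨y, Φ, rfl, (Category.id_comp _).symm, (isCart_iff _ _).2 fun {a} k ψ hψ => ?_⟩
  have h₁ : ψ.fst = k.fst ≫ f₁ := congrArg Hom.fst hψ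
  have h₂ : R.map ψ.snd = k.snd ≫ R.map φ := congrArg Hom.snd hψ
  obtain ⟨χ, hχ, hχ'⟩ := hφc.exists_lift _ _ h₂
  refine ⟨⟨k.fst, χ, ?_⟩, ⟨Pullback.hom_ext rfl hχ, Pullback.hom_ext h₁.symm hχ'⟩, ?_⟩
  · rw [Functor.comp_map, hχ]
    exact k.w
  · intro (z : a ⟶ y) ⟨hz, hz'⟩
    have hz₁ : z.fst = k.fst := congrArg Hom.fst (show (mapSnd F P R).map z = k from hz)
    refine Pullback.hom_ext hz₁ (hφc.hom_ext ?_ ?_)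
    · rw [hχ]
      exact congrArg Hom.snd hz
    · rw [hχ', ← hz']
      rfl

end Pullback

end Pullback

/-! ## The simple fibration -/

section Simple

variable (C : Type u₁) [Category.{v₁} C] [CartesianMonoidalCategory C]

/-- Objects of the total category of the simple fibration: an object `ty` in context `ctx`. -/
structure Simple where
  ctx : C
  ty : C

namespace Simple

variable {C}

/-- A morphism `(I, X) ⟶ (J, Y)` is a pair of `u : I ⟶ J` and `f : I × X ⟶ Y`. -/
@[ext]
structure Hom (x y : Simple C) where
  ctx : x.ctx ⟶ y.ctx
  ty : x.ctx ⊗ x.ty ⟶ y.ty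

open CartesianMonoidalCategory

instance : Category (Simple C) where
  Hom := Hom
  id x := ⟨𝟙 _, snd _ _⟩
  comp f g := ⟨f.ctx ≫ g.ctx, lift (fst _ _ ≫ f.ctx) f.ty ≫ g.ty⟩
  id_comp f := Hom.ext (Category.id_comp _) (by simp)
  comp_id f := Hom.ext (Category.comp_id _) (by simp)
  assoc f g h := Hom.ext (Category.assoc _ _ _) (by
    simp only [← Category.assoc]
    congr 1
    ext <;> simp)

@[ext]
theorem hom_ext {x y : Simple C} {f g : x ⟶ y} (h₁ : f.ctx = g.ctx) (h₂ : f.ty = g.ty) : f = g :=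
  Hom.ext h₁ h₂

@[simp] theorem id_ctx (x : Simple C) : Hom.ctx (𝟙 x) = 𝟙 x.ctx := rfl
@[simp] theorem id_ty (x : Simple C) : Hom.ty (𝟙 x) = snd x.ctx x.ty := rfl
@[simp] theorem comp_ctx {x y z : Simple C} (f : x ⟶ y) (g : y ⟶ z) :
    (f ≫ g).ctx = f.ctx ≫ g.ctx := rfl
@[simp] theorem comp_ty {x y z : Simple C} (f : x ⟶ y) (g : y ⟶ z) :
    (f ≫ g).ty = lift (fst _ _ ≫ f.ctx) f.ty ≫ g.ty := rfl

variable (C)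

/-- The simple fibration `S : Simple C ⥤ C`, `(I, X) ↦ I`. -/
@[simps]
def proj : Simple C ⥤ C where
  obj x := x.ctx
  map f := f.ctx

/-- The product functor `× : Simple C ⥤ C`, `(I, X) ↦ I × X`. -/
@[simps]
def prod : Simple C ⥤ C where
  obj x := x.ctx ⊗ x.ty
  map f := lift (fst _ _ ≫ f.ctx) f.ty

instance proj_isFibered : (proj C).IsFibered := by
  refine isFibered_of_exists _ fun d x f => ?_
  change x ⟶ d.ctx at f
  let y : Simple C := ⟨x, d.ty⟩
  let Φ : y ⟶ d := ⟨f, snd _ _⟩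
  refine ⟨y, Φ, rfl, (Category.id_comp _).symm, (isCart_iff _ _).2 fun {a} g ψ hψ => ?_⟩
  have hψ' : ψ.ctx = g ≫ f := hψ
  refine ⟨⟨g, ψ.ty⟩, ⟨rfl, Simple.hom_ext hψ'.symm (lift_snd _ _)⟩, ?_⟩
  rintro z ⟨hz, hz'⟩
  refine Simple.hom_ext hz ?_
  rw [← hz']
  exact (lift_snd _ _).symm

end Simple

end Simple

/-! ## Simple sums and products, and the simple Dialectica construction -/

section SimpleDial

variable {C : Type u₁} [Category.{v₁} C] [CartesianMonoidalCategory C]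
  {E : Type u₂} [Category.{v₂} E]

/-- The total category of the simple sum completion of `P : E ⥤ C`: the pullback of `P` along
`× : Simple C ⥤ C`. -/
abbrev SumTotal (P : E ⥤ C) := Pullback (Simple.prod C) P

/-- The pullback of `P` along `× : Simple C ⥤ C`. -/
abbrev sumToSimple (P : E ⥤ C) : SumTotal P ⥤ Simple C := Pullback.fstFunctor (Simple.prod C) P

/-- The simple sum completion `Sum(P)`. -/
abbrev sum (P : E ⥤ C) : SumTotal P ⥤ C := sumToSimple P ⋙ Simple.proj C

/-- The total category of the simple product completion `Prod(P) = Sum(P^∨)^∨`. -/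
abbrev ProdTotal (P : E ⥤ C) [P.IsFibered] := Dual (sum (dual P))

/-- The simple product completion `Prod(P) = Sum(P^∨)^∨`. -/
noncomputable abbrev prod (P : E ⥤ C) [P.IsFibered] : ProdTotal P ⥤ C := dual (sum (dual P))

/-- The total category of Hofstra's `Dial(P) = Sum(Prod(P))`. -/
abbrev DialTotal (P : E ⥤ C) [P.IsFibered] := SumTotal (prod P)

/-- Hofstra's fibration `Dial(P) = Sum(Prod(P))`. -/
noncomputable abbrev dial (P : E ⥤ C) [P.IsFibered] : DialTotal P ⥤ C := sum (prod P)

variable (C) in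
/-- The bottom level of the tower, the simple fibration `S : Simple C ⥤ C`. -/
abbrev simpleQ₁ : Simple C ⥤ C := Simple.proj C

variable (C) in
/-- The middle level of the tower, `Sum(S) = Simple C ×_C Simple C ⥤ Simple C`, the pullback of `S`
along `×`. -/
abbrev simpleQ₂ : SumTotal (Simple.proj C) ⥤ Simple C := sumToSimple (Simple.proj C)

/-- The top level of the tower, `Sum(Sum(P)) ⥤ Sum(S)`, induced by `Sum(P) ⥤ Simple C`. -/
abbrev simpleQ₃ (P : E ⥤ C) : SumTotal (sum P) ⥤ SumTotal (Simple.proj C) :=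
  Pullback.mapSnd (Simple.prod C) (Simple.proj C) (sumToSimple P)

end SimpleDial

/-! ## Families, cofamilies and the dependent Dialectica construction -/

section DependentDial

variable {X : Type u₁} [Category.{v₁} X] {E : Type u₂} [Category.{v₂} E]

/-- The domain functor `dom : X^↓ ⥤ X`. -/
abbrev dom (X : Type u₁) [Category.{v₁} X] : Arrow X ⥤ X := Arrow.leftFunc

/-- The codomain functor `cod : X^↓ ⥤ X`. -/
abbrev cod (X : Type u₁) [Category.{v₁} X] : Arrow X ⥤ X := Arrow.rightFunc

/-- If `X` has pullbacks, the codomain functor is a fibration. -/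
instance cod_isFibered [HasPullbacks X] : (cod X).IsFibered := by
  refine isFibered_of_exists _ fun d x f => ?_
  change x ⟶ d.right at f
  let y : Arrow X := Arrow.mk (pullback.snd d.hom f)
  let Φ : y ⟶ d := Arrow.homMk (pullback.fst d.hom f) f pullback.condition
  refine ⟨y, Φ, rfl, (Category.id_comp _).symm, (isCart_iff _ _).2 fun {a} g ψ hψ => ?_⟩
  change a.right ⟶ x at g
  have hψ' : ψ.right = g ≫ f := hψ
  have hw : ψ.left ≫ d.hom = (a.hom ≫ g) ≫ f := by
    rw [Category.assoc, ← hψ']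
    exact ψ.w
  refine ⟨Arrow.homMk (pullback.lift ψ.left (a.hom ≫ g) hw) g (pullback.lift_snd _ _ _),
    ⟨rfl, ?_⟩, ?_⟩
  · ext
    · exact pullback.lift_fst _ _ _
    · exact hψ'.symm
  · intro (z : a ⟶ y) ⟨hz, hz'⟩
    have hz1 : z.right = g := hz
    have hz2 : z.left ≫ pullback.fst d.hom f = ψ.left := congrArg (fun k => k.left) hz'
    have hz3 : z.left ≫ pullback.snd d.hom f = a.hom ≫ z.right := z.w
    ext
    · refine pullback.hom_ext (hz2.trans (pullback.lift_fst _ _ _).symm) (hz3.trans ?_)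
      rw [hz1]
      exact (pullback.lift_snd _ _ _).symm
    · exact hz1

/-- The total category of `Fam(P)`: the pullback of `P` along `dom : X^↓ ⥤ X`. -/
abbrev FamTotal (P : E ⥤ X) := Pullback (dom X) P

/-- The pullback of `P` along `dom : X^↓ ⥤ X`. -/
abbrev famToArrow (P : E ⥤ X) : FamTotal P ⥤ Arrow X := Pullback.fstFunctor (dom X) P

/-- The family fibration `Fam(P)` (the sum completion of `P`). -/
abbrev fam (P : E ⥤ X) : FamTotal P ⥤ X := famToArrow P ⋙ cod X

/-- The total category of the product completion `Cofam(P) = Fam(P^∨)^∨`. -/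
abbrev CofamTotal [HasPullbacks X] (P : E ⥤ X) [P.IsFibered] := Dual (fam (dual P))

/-- The product completion `Cofam(P) = Fam(P^∨)^∨`. -/
noncomputable abbrev cofam [HasPullbacks X] (P : E ⥤ X) [P.IsFibered] : CofamTotal P ⥤ X :=
  dual (fam (dual P))

/-- The total category of the dependent Dialectica construction `Fam(Cofam(P))`. -/
abbrev DepDialTotal [HasPullbacks X] (P : E ⥤ X) [P.IsFibered] := FamTotal (cofam P)

/-- The dependent Dialectica construction `Dial(P) = Fam(Cofam(P))`. -/
noncomputable abbrev depDial [HasPullbacks X] (P : E ⥤ X) [P.IsFibered] : DepDialTotal P ⥤ X :=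
  fam (cofam P)

variable (X) in
/-- The bottom level of the dependent tower, `cod : X^↓ ⥤ X`. -/
abbrev depQ₁ : Arrow X ⥤ X := cod X

variable (X) in
/-- The middle level of the dependent tower, the pullback `Fam(cod) ⥤ X^↓` of `cod` along `dom`. -/
abbrev depQ₂ : FamTotal (cod X) ⥤ Arrow X := famToArrow (cod X)

/-- The top level of the dependent tower, `Fam(Fam(P)) ⥤ Fam(cod)`, induced by `Fam(P) ⥤ X^↓`. -/
abbrev depQ₃ (P : E ⥤ X) : FamTotal (fam P) ⥤ FamTotal (cod X) :=
  Pullback.mapSnd (dom X) (cod X) (famToArrow P)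

end DependentDial

/-! ## Isomorphisms of categories over a base -/

/-- An isomorphism of categories over `X`, from `p : A ⥤ X` to `q : B ⥤ X`. -/
structure IsoOver {A : Type u₁} [Category.{v₁} A] {B : Type u₂} [Category.{v₂} B]
    {X : Type u₃} [Category.{v₃} X] (p : A ⥤ X) (q : B ⥤ X) where
  hom : A ⥤ B
  inv : B ⥤ A
  hom_inv_id : hom ⋙ inv = 𝟭 A
  inv_hom_id : inv ⋙ hom = 𝟭 B
  hom_over : hom ⋙ q = p

end Dialens

/-!
The particular shape of `×`, `S`, `dom` and `cod` plays no role: for an arbitrary functor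
`F : B ⥤ X` and an arbitrary fibration `S : B ⥤ X`, the construction
`R ↦ (F^*R followed by S)` satisfies the decomposition (`exists_isoOver_iteratedDual`), and the
simple and dependent cases are the instances `(×, S)` and `(dom, cod)`.

The argument rests on two properties of the dual.

* The dual is stable under pullback: `(F^*P)^∨` and `F^*(P^∨)` are isomorphic over `B`
  (`dualPullback`). An arrow of `F^*P` is cartesian exactly if its component in `E` is, so a span
  in `F^*P` gives one in `E`. Conversely, a span in `E` is equivalent to one whose vertical leg lies
  over an identity, and the apex of such a span lifts strictly to the pullback.
* The dual is invariant under isomorphisms over the base (`dualMap`).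

The top level `Q₃` of the tower is, up to rebracketing triples (`pullbackAssoc`), the pullback of
`P` along `B ×_X B ⥤ B ⥤ X`, the second projection followed by `F`. Stability under pullback
therefore identifies `Q₃^∨` with the same iterated pullback formed from `P^∨` (`dualTop`), so that
`Q₃^∨` followed by `Q₂` becomes the pullback along `F` of the fibration `F^*(P^∨)` followed by `S`.
Taking the dual over `B` and using stability under pullback once more gives the pullback along `F`
of the product completion of `P` (`towerToDial`).

All comparison functors are built as fully faithful functors which only rebracket objects; a strict
inverse is extracted once, at the end, by `strictInverse`.
-/

namespace Dialens

/-! ### Isomorphisms of categories from fully faithful functors -/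

section StrictInverse

variable {A : Type u₁} [Category.{v₁} A] {B : Type u₂} [Category.{v₂} B]

/-- The strict inverse of a fully faithful functor `T` with a strict inverse `g` on objects. -/
noncomputable def strictInverse (T : A ⥤ B) [T.Full] [T.Faithful] (g : B → A)
    (hg : ∀ b, T.obj (g b) = b) : B ⥤ A where
  obj := g
  map f := T.preimage (eqToHom (hg _) ≫ f ≫ eqToHom (hg _).symm)
  map_id b := T.map_injective (by simp)
  map_comp f f' := T.map_injective (by simp)

theorem strictInverse_comp (T : A ⥤ B) [T.Full] [T.Faithful] (g : B → A)
    (hg : ∀ b, T.obj (g b) = b) : strictInverse T g hg ⋙ T = 𝟭 B :=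
  CategoryTheory.Functor.ext hg fun _ _ f => by simp [strictInverse]

theorem comp_strictInverse (T : A ⥤ B) [T.Full] [T.Faithful] (g : B → A)
    (hg : ∀ b, T.obj (g b) = b) (hg' : ∀ a, g (T.obj a) = a) :
    T ⋙ strictInverse T g hg = 𝟭 A :=
  CategoryTheory.Functor.ext hg' fun a a' f => T.map_injective (by
    change T.map (T.preimage _) = T.map (eqToHom (hg' a) ≫ f ≫ eqToHom (hg' a').symm)
    rw [T.map_preimage, T.map_comp, T.map_comp, eqToHom_map, eqToHom_map])

end StrictInverse

/-! ### Invariance of the dual -/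

section DualMap

variable {A : Type u₁} [Category.{v₁} A] {B : Type u₂} [Category.{v₂} B]
  {X : Type u₃} [Category.{v₃} X] {T : A ⥤ B} {p : A ⥤ X} {q : B ⥤ X}

theorem isVert_map_iff (h : T ⋙ q = p) {e d : A} (φ : e ⟶ d) :
    IsVert q (T.map φ) ↔ IsVert p φ := by
  subst h
  rfl

/-- The universal property of a cartesian arrow only tests morphisms out of objects of the total
category, and it suffices to test the objects in the image of `T`. -/
theorem isCart_map_iff [T.Full] [T.Faithful] [T.EssSurj] (h : T ⋙ q = p) {e d : A} (φ : e ⟶ d) :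
    IsCart q (T.map φ) ↔ IsCart p φ := by
  subst h
  constructor
  · intro hc
    refine (isCart_iff _ _).2 fun {a} g ψ hψ => ?_
    obtain ⟨χ, h₁, h₂⟩ := hc.exists_lift g (T.map ψ) hψ
    obtain ⟨χ, rfl⟩ := T.map_surjective χ
    refine ⟨χ, ⟨h₁, T.map_injective (by rw [T.map_comp, h₂])⟩, ?_⟩
    rintro y ⟨hy₁, hy₂⟩
    refine T.map_injective (hc.hom_ext (hy₁.trans h₁.symm) ?_)
    rw [h₂, ← T.map_comp, hy₂]
  · intro hc
    refine (isCart_iff _ _).2 fun {b} g ψ hψ => ?_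
    -- Test objects of `B` are replaced by isomorphic ones in the image of `T`.
    let i := T.objObjPreimageIso b
    obtain ⟨k, hk⟩ := T.map_surjective (i.hom ≫ ψ)
    have e1 : (T ⋙ q).map k = (q.map i.hom ≫ g) ≫ (T ⋙ q).map φ := by
      change q.map (T.map k) = _ ≫ q.map (T.map φ)
      rw [hk, q.map_comp, hψ, Category.assoc]
    obtain ⟨χ, h₁, h₂⟩ := hc.exists_lift (q.map i.hom ≫ g) k e1
    have h₁' : q.map (T.map χ) = q.map i.hom ≫ g := h₁
    refine ⟨i.inv ≫ T.map χ, ⟨?_, ?_⟩, ?_⟩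
    · rw [q.map_comp, h₁', ← Category.assoc, ← q.map_comp, i.inv_hom_id, q.map_id,
        Category.id_comp]
    · rw [Category.assoc, ← T.map_comp, h₂, hk, i.inv_hom_id_assoc]
    · rintro y ⟨hy₁, hy₂⟩
      obtain ⟨l, hl⟩ := T.map_surjective (i.hom ≫ y)
      have : l = χ := by
        refine hc.hom_ext ?_ (T.map_injective ?_)
        · rw [h₁]
          change q.map (T.map l) = _
          rw [hl, q.map_comp, hy₁]
        · rw [T.map_comp, hl, Category.assoc, hy₂, ← hk, h₂]
      rw [← this, hl, i.inv_hom_id_assoc]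

variable [T.Full] [T.Faithful] [T.EssSurj]

/-- The image of a span under a fully faithful, essentially surjective functor over the base. -/
def Span.mapOver (h : T ⋙ q = p) {e d : A} (s : Span p e d) : Span q (T.obj e) (T.obj d) where
  apex := T.obj s.apex
  left := T.map s.left
  right := T.map s.right
  vert := (isVert_map_iff h _).2 s.vert
  cart := (isCart_map_iff h _).2 s.cart

theorem Span.mapOver_rel (h : T ⋙ q = p) {e d : A} {s t : Span p e d} :
    s.mapOver h ≈ t.mapOver h ↔ s ≈ t := by
  constructor
  · rintro ⟨θ, h₁, h₂⟩
    obtain ⟨k, hk⟩ := T.map_surjective θ.hom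
    simp only [Span.mapOver] at h₁ h₂
    exact Span.rel_of_hom k (T.map_injective (by rw [T.map_comp, hk, h₁]))
      (T.map_injective (by rw [T.map_comp, hk, h₂]))
  · rintro ⟨θ, h₁, h₂⟩
    exact ⟨T.mapIso θ, by simp [Span.mapOver, ← h₁], by simp [Span.mapOver, ← h₂]⟩

variable [p.IsFibered] [q.IsFibered]

/-- The functor between duals induced by a fully faithful, essentially surjective functor over
the base. -/
noncomputable def dualMap (h : T ⋙ q = p) : Dual p ⥤ Dual q where
  obj e := ⟨T.obj e.of⟩
  map f := Quotient.map (Span.mapOver h) (fun _ _ hs => (Span.mapOver_rel h).2 hs) f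
  map_id e := Quotient.sound (Span.rel_of_hom (𝟙 _) (by simp [Span.mapOver, Span.id])
    (by simp [Span.mapOver, Span.id]))
  map_comp f g := by
    induction f using Quotient.inductionOn with
    | _ s =>
      induction g using Quotient.inductionOn with
      | _ t =>
        obtain ⟨u, w, k, hw, hk, hs, e⟩ := s.comp_eq_paste t
        refine Quotient.sound ?_
        rw [e]
        refine Setoid.symm (Setoid.trans (Span.comp_rel_paste (Setoid.refl _) (Setoid.refl _)
          (w := T.map w) (k := T.map k) (hw := (isVert_map_iff h _).2 hw)
          (hk := (isCart_map_iff h _).2 hk) ?_) ?_)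
        · simp only [Span.mapOver, ← T.map_comp, hs]
        · exact Span.rel_of_hom (𝟙 _) (by simp [Span.mapOver, Span.paste])
            (by simp [Span.mapOver, Span.paste])

theorem dualMap_comp_dual (h : T ⋙ q = p) : dualMap h ⋙ dual q = dual p := by
  subst h
  refine CategoryTheory.Functor.hext (fun _ => rfl) fun e d f => ?_
  induction f using Quotient.inductionOn with
  | _ s => exact HEq.rfl

instance dualMap_faithful (h : T ⋙ q = p) : (dualMap h).Faithful where
  map_injective {_ _ f g} hfg := by
    induction f using Quotient.inductionOn with
    | _ s =>
      induction g using Quotient.inductionOn with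
      | _ t => exact Quotient.sound ((Span.mapOver_rel h).1 (Quotient.exact hfg))

instance dualMap_full (h : T ⋙ q = p) : (dualMap h).Full where
  map_surjective {e d} f := by
    induction f using Quotient.inductionOn with
    | _ s =>
      change Span q (T.obj e.of) (T.obj d.of) at s
      let i := T.objObjPreimageIso s.apex
      obtain ⟨l, hl⟩ := T.map_surjective (i.hom ≫ s.left)
      obtain ⟨r, hr⟩ := T.map_surjective (i.hom ≫ s.right)
      refine ⟨Quotient.mk _ ⟨T.objPreimage s.apex, l, r, (isVert_map_iff h l).1 ?_,
        (isCart_map_iff h r).1 ?_⟩, Quotient.sound ⟨i, hl.symm, hr.symm⟩⟩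
      · have := s.vert
        rw [hl]
        unfold IsVert
        rw [q.map_comp]
        infer_instance
      · rw [hr]
        exact (IsCart.of_isIso i.hom).comp s.cart

end DualMap

/-! ### Duals commute with pullback -/

section DualPullback

variable {B : Type u₁} [Category.{v₁} B] {E : Type u₂} [Category.{v₂} E]
  {X : Type u₃} [Category.{v₃} X]

namespace Pullback

/-- The second projection of the pullback. -/
def sndFunctor (F : B ⥤ X) (P : E ⥤ X) : Pullback F P ⥤ E where
  obj x := x.snd
  map f := f.snd

variable {F : B ⥤ X} {P : E ⥤ X}

theorem map_snd {x y : Pullback F P} (f : x ⟶ y) :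
    P.map f.snd = eqToHom x.w.symm ≫ F.map f.fst ≫ eqToHom y.w := by
  rw [f.w]
  simp

theorem isVert_snd {x y : Pullback F P} {φ : x ⟶ y} (h : IsVert (fstFunctor F P) φ) :
    IsVert P φ.snd := by
  have : IsIso φ.fst := h
  unfold IsVert
  rw [map_snd]
  infer_instance

theorem isCart_of_snd {x y : Pullback F P} {φ : x ⟶ y} (h : IsCart P φ.snd) :
    IsCart (fstFunctor F P) φ := by
  refine (isCart_iff _ _).2 fun {a} g ψ hψ => ?_
  change a.fst ⟶ x.fst at g
  have hψ' : ψ.fst = g ≫ φ.fst := hψ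
  obtain ⟨χ, hχ, hχ'⟩ := h.exists_lift (eqToHom a.w.symm ≫ F.map g ≫ eqToHom x.w) ψ.snd
    (by rw [map_snd, map_snd, hψ']; simp)
  refine ⟨⟨g, χ, by rw [hχ]; simp⟩, ⟨rfl, Pullback.hom_ext hψ'.symm hχ'⟩, ?_⟩
  rintro z ⟨hz, hz'⟩
  have hz1 : z.fst = g := hz
  refine Pullback.hom_ext hz1 (h.hom_ext ?_ ?_)
  · rw [hχ, map_snd, hz1]
  · rw [hχ', ← hz']
    rfl

theorem isCart_snd [P.IsFibered] {x y : Pullback F P} {φ : x ⟶ y}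
    (h : IsCart (fstFunctor F P) φ) : IsCart P φ.snd := by
  -- `φ` is compared with a lift of `φ.fst` whose second component is cartesian.
  obtain ⟨e, ψ, he, hψ, hψc⟩ := exists_cart_lift P y.snd (F.map φ.fst ≫ eqToHom y.w)
  let z : Pullback F P := ⟨x.fst, e, he.symm⟩
  let Ψ : z ⟶ y := ⟨φ.fst, ψ, by rw [hψ]; simp [z]⟩
  have hΨ : IsCart (fstFunctor F P) Ψ := isCart_of_snd hψc
  obtain ⟨χ, h₁, h₂⟩ := hΨ.exists_lift (𝟙 x.fst) φ (Category.id_comp _).symm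
  have hv : IsVert (fstFunctor F P) χ := by
    unfold IsVert
    rw [h₁]
    exact inferInstanceAs (IsIso (𝟙 x.fst))
  have hi : IsIso χ := IsCart.isIso (hΨ.of_comp (by rwa [h₂])) hv
  have : IsIso χ.snd := inferInstanceAs (IsIso ((sndFunctor F P).map χ))
  rw [← h₂]
  exact (IsCart.of_isIso χ.snd).comp hψc

end Pullback

open Dialens.Pullback

variable {F : B ⥤ X} {P : E ⥤ X} [P.IsFibered]

/-- The span in the second component of a span in a pullback. -/
def Span.pullbackSnd {x y : Pullback F P} (s : Span (fstFunctor F P) x y) :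
    Span P x.snd y.snd where
  apex := s.apex.snd
  left := s.left.snd
  right := s.right.snd
  vert := isVert_snd s.vert
  cart := isCart_snd s.cart

theorem Span.pullbackSnd_rel {x y : Pullback F P} {s t : Span (fstFunctor F P) x y} (h : s ≈ t) :
    s.pullbackSnd ≈ t.pullbackSnd := by
  obtain ⟨θ, h₁, h₂⟩ := h
  exact ⟨(sndFunctor F P).mapIso θ, congrArg Hom.snd h₁, congrArg Hom.snd h₂⟩

theorem Span.pullbackSnd_base {x y : Pullback F P} (s : Span (fstFunctor F P) x y)
    {b : x.fst ⟶ y.fst} (h : s.left.fst ≫ b = s.right.fst) :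
    s.pullbackSnd.base = eqToHom x.w.symm ≫ F.map b ≫ eqToHom y.w := by
  refine Span.base_unique _ _ ?_
  simp only [Span.pullbackSnd]
  rw [map_snd, map_snd, ← h, F.map_comp]
  simp

variable (F P) in
/-- The comparison `(F^*P)^∨ ⥤ F^*(P^∨)` between the dual of the pullback and the pullback of the
dual. Its first component is taken to be the action of the dual fibration `(F^*P)^∨ ⥤ B`, so that
it is a functor over `B` by definition. -/
noncomputable def dualPullback : Dual (fstFunctor F P) ⥤ Pullback F (dual P) where
  obj x := ⟨x.of.fst, ⟨x.of.snd⟩, x.of.w⟩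
  map {x y} f :=
    { fst := (dual (fstFunctor F P)).map f
      snd := Quotient.map Span.pullbackSnd (fun _ _ h => Span.pullbackSnd_rel h) f
      w := by
        induction f using Quotient.inductionOn with
        | _ s =>
          change F.map (X := x.of.fst) (Y := y.of.fst) s.base ≫ eqToHom y.of.w =
            eqToHom x.of.w ≫ s.pullbackSnd.base
          rw [s.pullbackSnd_base (b := s.base) s.map_left_base]
          simp }
  map_id x := by
    refine Pullback.hom_ext ((dual (fstFunctor F P)).map_id x) ?_
    exact Quotient.sound (Setoid.refl _)
  map_comp f g := by
    refine Pullback.hom_ext ((dual (fstFunctor F P)).map_comp f g) ?_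
    induction f using Quotient.inductionOn with
    | _ s =>
      induction g using Quotient.inductionOn with
      | _ t =>
        obtain ⟨u, w, k, hw, hk, hs, e⟩ := s.comp_eq_paste t
        refine Quotient.sound ?_
        rw [e]
        exact Setoid.symm (Span.comp_rel_paste (Setoid.refl s.pullbackSnd)
          (Setoid.refl t.pullbackSnd) (w := w.snd) (k := k.snd) (hw := isVert_snd hw)
          (hk := isCart_snd hk) (congrArg Hom.snd hs))

instance dualPullback_faithful : (dualPullback F P).Faithful where
  map_injective {x y f g} hfg := by
    induction f using Quotient.inductionOn with
    | _ s =>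
      induction g using Quotient.inductionOn with
      | _ t =>
        have hbase : s.base = t.base := congrArg Hom.fst hfg
        have hr : s.pullbackSnd ≈ t.pullbackSnd := Quotient.exact (congrArg Hom.snd hfg)
        obtain ⟨θ, h₁, h₂⟩ := hr
        change s.apex.snd ≅ t.apex.snd at θ
        change θ.hom ≫ t.left.snd = s.left.snd at h₁
        have : IsIso t.left.fst := t.vert
        obtain ⟨b, hs, ht⟩ : ∃ b : x.of.fst ⟶ y.of.fst,
            s.left.fst ≫ b = s.right.fst ∧ t.left.fst ≫ b = t.right.fst :=
          ⟨s.base, s.map_left_base, hbase ▸ t.map_left_base⟩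
        -- The first component of an isomorphism of spans is determined by the vertical legs.
        have e1 : F.map (s.left.fst ≫ inv t.left.fst) ≫ eqToHom t.apex.w =
            eqToHom s.apex.w ≫ P.map θ.hom := by
          have : IsIso (P.map t.left.snd) := isVert_snd t.vert
          rw [← cancel_mono (P.map t.left.snd), Category.assoc, Category.assoc, ← P.map_comp,
            h₁, ← s.left.w, ← t.left.w, ← Category.assoc, ← F.map_comp, Category.assoc,
            IsIso.inv_hom_id, Category.comp_id]
        let k : s.apex ⟶ t.apex := ⟨s.left.fst ≫ inv t.left.fst, θ.hom, e1⟩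
        refine Quotient.sound (Span.rel_of_hom k (Pullback.hom_ext ?_ h₁)
          (Pullback.hom_ext ?_ h₂))
        · simp [k]
        · change (s.left.fst ≫ inv t.left.fst) ≫ t.right.fst = s.right.fst
          rw [← hs, ← ht, Category.assoc, IsIso.inv_hom_id_assoc]

instance dualPullback_full : (dualPullback F P).Full where
  map_surjective {x y} f := by
    obtain ⟨b, σ, hf⟩ := f
    induction σ using Quotient.inductionOn with
    | _ s =>
      change x.of.fst ⟶ y.of.fst at b
      change Span P x.of.snd y.of.snd at s
      have hf' : F.map b ≫ eqToHom y.of.w = eqToHom x.of.w ≫ s.base := hf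
      -- The vertical leg is made to lie over an identity, so that the apex lifts to the pullback.
      have := s.vert
      obtain ⟨a, i, ha, hi, hic⟩ := exists_cart_lift P s.apex (inv (P.map s.left))
      have hil : P.map (i ≫ s.left) = eqToHom ha := by
        rw [P.map_comp, hi]
        simp
      have hii : IsIso i := hic.isIso (by unfold IsVert; rw [hi]; infer_instance)
      let z : Pullback F P := ⟨x.of.fst, a, x.of.w.trans ha.symm⟩
      let l : z ⟶ x.of := ⟨𝟙 _, i ≫ s.left, by rw [hil]; simp [z]⟩
      let r : z ⟶ y.of := ⟨b, i ≫ s.right, by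
        rw [hf', P.map_comp, ← s.map_left_base, ← Category.assoc (P.map i), ← P.map_comp, hil]
        simp [z]⟩
      let t : Span (fstFunctor F P) x.of y.of :=
        { apex := z
          left := l
          right := r
          vert := inferInstanceAs (IsIso (𝟙 x.of.fst))
          cart := isCart_of_snd ((IsCart.of_isIso i).comp s.cart) }
      refine ⟨Quotient.mk _ t, Pullback.hom_ext ?_ ?_⟩
      · exact t.base_unique b (Category.id_comp b)
      · exact Quotient.sound (Span.rel_of_hom (s := t.pullbackSnd) (t := s) i rfl rfl)

end DualPullback

/-! ### Sums along a functor on the total category of a fibration -/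

section GeneralSum

variable {X : Type u₁} [Category.{v₁} X] {E : Type u₂} [Category.{v₂} E]
  {B : Type u₃} [Category.{v₃} B]

open Dialens.Pullback

/-- The pullback of `P` along `B ×_X B ⥤ B ⥤ X`, the second projection followed by `F`, is
an iterated pullback, with the same triples as objects. -/
def pullbackAssoc (F S : B ⥤ X) (P : E ⥤ X) :
    Pullback (sndFunctor F S ⋙ F) P ⥤ Pullback F (fstFunctor F P ⋙ S) where
  obj x := ⟨x.fst.fst, ⟨x.fst.snd, x.snd, x.w⟩, x.fst.w⟩
  map f := ⟨f.fst.fst, ⟨f.fst.snd, f.snd, f.w⟩, f.fst.w⟩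

/-- The inverse of `pullbackAssoc`. -/
def pullbackAssocInv (F S : B ⥤ X) (P : E ⥤ X) :
    Pullback F (fstFunctor F P ⋙ S) ⥤ Pullback (sndFunctor F S ⋙ F) P where
  obj x := ⟨⟨x.fst, x.snd.fst, x.w⟩, x.snd.snd, x.snd.w⟩
  map f := ⟨⟨f.fst, f.snd.fst, f.w⟩, f.snd.snd, f.snd.w⟩

variable (F S : B ⥤ X) (P : E ⥤ X)

/-- `pullbackAssoc` and `pullbackAssocInv` as an equivalence; both triangles are strict. -/
def pullbackAssocEquiv :
    Pullback (sndFunctor F S ⋙ F) P ≌ Pullback F (fstFunctor F P ⋙ S) :=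
  CategoryTheory.Equivalence.mk (pullbackAssoc F S P) (pullbackAssocInv F S P)
    (Iso.refl _) (Iso.refl _)

instance : (pullbackAssoc F S P).IsEquivalence := (pullbackAssocEquiv F S P).isEquivalence_functor

instance : (pullbackAssocInv F S P).IsEquivalence :=
  (pullbackAssocEquiv F S P).isEquivalence_inverse

theorem pullbackAssocInv_comp :
    pullbackAssocInv F S P ⋙ fstFunctor (sndFunctor F S ⋙ F) P =
      mapSnd F S (fstFunctor F P) :=
  rfl

variable [P.IsFibered]

/-- The dual of the top level of the tower is the same iterated pullback, formed from `P^∨`. -/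
noncomputable def dualTop :
    Dual (mapSnd F S (fstFunctor F P)) ⥤ Pullback F (fstFunctor F (dual P) ⋙ S) :=
  dualMap (pullbackAssocInv_comp F S P) ⋙ dualPullback (sndFunctor F S ⋙ F) P ⋙
    pullbackAssoc F S (dual P)

instance : (dualTop F S P).Full := by
  unfold dualTop
  infer_instance

instance : (dualTop F S P).Faithful := by
  unfold dualTop
  infer_instance

instance : (dualTop F S P).EssSurj :=
  ⟨fun x => ⟨⟨⟨x.fst, ⟨x.snd.fst, x.snd.snd.of, x.snd.w⟩, x.w⟩⟩, ⟨Iso.refl _⟩⟩⟩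

theorem dualTop_comp :
    dualTop F S P ⋙ fstFunctor F (fstFunctor F (dual P) ⋙ S) =
      dual (mapSnd F S (fstFunctor F P)) ⋙ fstFunctor F S := by
  rw [← dualMap_comp_dual (pullbackAssocInv_comp F S P)]
  rfl

variable [S.IsFibered]

/-- The comparison from the iterated dual of the tower to the sum of the product completion. -/
noncomputable def towerToDial :
    IteratedDual (mapSnd F S (fstFunctor F P)) (fstFunctor F S) ⥤
      Pullback F (dual (fstFunctor F (dual P) ⋙ S)) :=
  dualMap (dualTop_comp F S P) ⋙ dualPullback F (fstFunctor F (dual P) ⋙ S)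

instance : (towerToDial F S P).Full := by
  unfold towerToDial
  infer_instance

instance : (towerToDial F S P).Faithful := by
  unfold towerToDial
  infer_instance

theorem towerToDial_comp :
    towerToDial F S P ⋙ fstFunctor F (dual (fstFunctor F (dual P) ⋙ S)) =
      iteratedDual (mapSnd F S (fstFunctor F P)) (fstFunctor F S) :=
  dualMap_comp_dual (dualTop_comp F S P)

/-- The decomposition of the Dialectica construction for an arbitrary functor `F : B ⥤ X` and
fibration `S : B ⥤ X`. -/
theorem exists_isoOver_iteratedDual :
    ∃ Φ : IsoOver (fstFunctor F (dual (fstFunctor F (dual P) ⋙ S)) ⋙ S)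
        (iteratedDual (mapSnd F S (fstFunctor F P)) (fstFunctor F S) ⋙ S),
      Φ.hom ⋙ iteratedDual (mapSnd F S (fstFunctor F P)) (fstFunctor F S) =
          fstFunctor F (dual (fstFunctor F (dual P) ⋙ S)) ∧
        ∀ d : Pullback F (dual (fstFunctor F (dual P) ⋙ S)),
          (Φ.hom.obj d).of.of.fst = d.fst ∧
          (Φ.hom.obj d).of.of.snd.fst = d.snd.of.fst ∧
          (Φ.hom.obj d).of.of.snd.snd = d.snd.of.snd.of := by
  let Ψ := strictInverse (towerToDial F S P)
    (fun d => ⟨⟨⟨d.fst, ⟨d.snd.of.fst, d.snd.of.snd.of, d.snd.of.w⟩, d.w⟩⟩⟩) fun _ => rfl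
  have h : Ψ ⋙ towerToDial F S P = 𝟭 _ := strictInverse_comp _ _ _
  have h' : towerToDial F S P ⋙ Ψ = 𝟭 _ := comp_strictInverse _ _ _ fun _ => rfl
  have hover : Ψ ⋙ iteratedDual (mapSnd F S (fstFunctor F P)) (fstFunctor F S) =
      fstFunctor F (dual (fstFunctor F (dual P) ⋙ S)) := by
    rw [← towerToDial_comp, ← Functor.assoc, h, Functor.id_comp]
  exact ⟨⟨Ψ, towerToDial F S P, h, h', by rw [← Functor.assoc, hover]⟩, hover,
    fun _ => ⟨rfl, rfl, rfl⟩⟩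

end GeneralSum

end Dialens

theorem mainTheorem3 :
    -- The simple case: `C` cartesian monoidal, `P` a fibration over `C`.
    (∀ {C : Type u₁} [Category.{v₁} C] [CartesianMonoidalCategory C]
        {E : Type u₂} [Category.{v₂} E] (P : E ⥤ C) [P.IsFibered],
      ∃ Φ : Dialens.IsoOver (Dialens.dial P)
          (Dialens.iteratedDual (Dialens.simpleQ₃ P) (Dialens.simpleQ₂ C) ⋙ Dialens.simpleQ₁ C),
        -- `Φ` is also an isomorphism over `Simple C`, and it is the identity on objects.
        Φ.hom ⋙ Dialens.iteratedDual (Dialens.simpleQ₃ P) (Dialens.simpleQ₂ C) =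
            Dialens.sumToSimple (Dialens.prod P) ∧
          ∀ d : Dialens.DialTotal P,
            (Φ.hom.obj d).of.of.fst = d.fst ∧
            (Φ.hom.obj d).of.of.snd.fst = d.snd.of.fst ∧
            (Φ.hom.obj d).of.of.snd.snd = d.snd.of.snd.of) ∧
    -- The dependent case: `X` with pullbacks, `P` a fibration over `X`.
    (∀ {X : Type u₁} [Category.{v₁} X] [HasPullbacks X]
        {E : Type u₂} [Category.{v₂} E] (P : E ⥤ X) [P.IsFibered],
      ∃ Φ : Dialens.IsoOver (Dialens.depDial P)
          (Dialens.iteratedDual (Dialens.depQ₃ P) (Dialens.depQ₂ X) ⋙ Dialens.depQ₁ X),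
        -- `Φ` is also an isomorphism over the arrow category, and it is the identity on objects.
        Φ.hom ⋙ Dialens.iteratedDual (Dialens.depQ₃ P) (Dialens.depQ₂ X) =
            Dialens.famToArrow (Dialens.cofam P) ∧
          ∀ d : Dialens.DepDialTotal P,
            (Φ.hom.obj d).of.of.fst = d.fst ∧
            (Φ.hom.obj d).of.of.snd.fst = d.snd.of.fst ∧
            (Φ.hom.obj d).of.of.snd.snd = d.snd.of.snd.of) :=
  ⟨fun P _ => Dialens.exists_isoOver_iteratedDual (Dialens.Simple.prod _) (Dialens.Simple.proj _) P,
    fun P _ => Dialens.exists_isoOver_iteratedDual (Dialens.dom _) (Dialens.cod _) P⟩
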